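/- **Conventions.** For $n\ge 0$ let $[n]=\{0,1,\dots,n\}$ with base point $0$, and let $\Gamma^{op}$ be the category of the pointed sets $[n]$ and all pointed maps. Identify $[m]\wedge[n]$ with $[mn]$ by the inverse lexicographical order, $i\wedge j\mapsto i+m(j-1)$ for $i,j\geq 1$. A $\Gamma$-ring is a functor $R$ from $\Gamma^{op}$ to pointed simplicial sets with $R[0]=[0]$, together with a natural unit $\eta:[n]\to R[n]$ and natural multiplication maps $R[m]\wedge R[n]\to R([m]\wedge[n])=R[mn]$ of pointed simplicial sets, which are associative and unital. It is discrete if all $R[n]$ are sets, i.e. constant simplicial sets. A multiplicative map of $\Gamma$-rings is a natural transformation that commutes with units and multiplications. For each $d\ge0$ the $d$-simplices of the $R[n]$ form a discrete $\Gamma$-ring $R_d$, and simplicial operators induce multiplicative maps between the $R_d$. $H\mathbf Z$ is the discrete $\Gamma$-ring with $H\mathbf Z[n]=\tilde{\mathbf Z}[n]=\mathbf Z^n$ (the reduced free abelian group on $[n]$), unit the embedding of generators, and multiplication $(\sum a_i\, i)(\sum b_j\, j)=\sum a_ib_j\,(i\wedge j)$. Write $p^n_i:[n]\to[n-1]$ for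 the pointed map that sends $i$ to $0$ and the remaining elements bijectively onto $[n-1]$ in order; $s^n_{i,j,l}:[n]\to[n-1]$ for the pointed map that sends $i$ and $j$ to $l$ and the remaining elements bijectively onto $[n-1]\setminus\{l\}$ in order; $d^n_j:[n-1]\to[n]$ for the order-preserving injection that misses $j$; and $\sigma:[2]\to[2]$ for the transposition of $1$ and $2$ (the indices $i,j,l$ are nonzero). Let $A_+\subset\{1,\dots,2^k\}$ be the set of those $i$ for which the binary expansion of $i-1$ has an even number of digits $1$, and $A_-$ its complement. The same symbol denotes a pointed map and the map it induces. A *formal difference law* in a discrete $\Gamma$-ring $A$ is an element $r\in A[2]$ such that 1. $p^2_2(r)=1$ and $s^2_{1,2,1}(r)=0$ in $A[1]$; 2. $p^2_1(r)\,r=r\,p^2_1(r)=\sigma(r)$ in $A[2]$; 3. for every $k$, the power $r^k\in A[2^k]$ is fixed by all permutations of $\{1,\dots,2^k\}$ that preserve $A_+$ and $A_-$; 4. for all $k$, all $1\le i<j\le 2^k$ of which one lies in $A_+$ and the other in $A_-$, and all $1\le l\le 2^k-1$, one has $s^{2^k}_{i,j,l}(r^k)=d^{2^k-1}_l\,p^{2^k-1}_i\,p^{2^k}_j(r^k)$.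 For a (not necessarily discrete) $\Gamma$-ring $R$, let $FDL(R)_*$ be the simplicial set whose set of $d$-simplices is the set of formal difference laws in $R_d$, and let $\Gamma(H\mathbf Z,R)_*$ be the simplicial set whose set of $d$-simplices is the set of multiplicative maps $H\mathbf Z\to R_d$; in both, the simplicial operators are induced by those of $R$. Both are functors of $R$ with respect to multiplicative maps $R\to R'$. **Theorem 3.8.** The simplicial sets $FDL(R)_*$ and $\Gamma(H\mathbf Z,R)_*$ are isomorphic, naturally in the $\Gamma$-ring $R$. More precisely, there is a natural isomorphism of functors $\Gamma(H\mathbf Z,-)_*\cong FDL(-)_*$, from $\Gamma$-rings to simplicial sets, which sends a multiplicative map $\phi:H\mathbf Z\to R_d$ to the formal difference law $\phi(1,-1)\in R_d[2]$, where $(1,-1)\in H\mathbf Z[2]=\mathbf Z^2$. -/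

import Mathlib

open CategoryTheory

universe u v w

namespace GammaSp

/-! ### The category of the finite pointed sets `[n] = {0, 1, …, n}` -/

/-- Objects of `Γᵒᵖ`: `⟨n⟩` is the pointed set `[n] = {0, …, n}`, with base point `0`. -/
structure GammaOp : Type where
  /-- the number of elements different from the base point -/
  card : ℕ

/-- Pointed maps `[m] → [n]`. -/
@[ext]
structure GammaOp.Hom (m n : GammaOp) : Type where
  /-- the underlying map of sets -/
  toFun : Fin (m.card + 1) → Fin (n.card + 1)
  map_zero : toFun 0 = 0

instance : Category GammaOp where
  Hom := GammaOp.Hom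
  id _ := ⟨id, rfl⟩
  comp f g := ⟨g.toFun ∘ f.toFun, by simp [f.map_zero, g.map_zero]⟩

@[simp] theorem id_toFun (m : GammaOp) : GammaOp.Hom.toFun (𝟙 m) = id := rfl

@[simp] theorem comp_toFun {m n p : GammaOp} (f : m ⟶ n) (g : n ⟶ p) :
    (f ≫ g).toFun = g.toFun ∘ f.toFun := rfl

/-- The inverse lexicographical enumeration of pairs, `(i, j) ↦ i + m * j` (indices from `0`). -/
def colex (m n : ℕ) : Fin m × Fin n ≃ Fin (m * n) :=
  (Equiv.prodComm _ _).trans (finProdFinEquiv.trans (finCongr (Nat.mul_comm n m)))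

theorem colex_val {m n : ℕ} (i : Fin m) (j : Fin n) :
    (colex m n (i, j) : ℕ) = i + m * j := by
  simp [colex]

/-- The element `x ∧ y` of `[m] ∧ [n]`, where `[m] ∧ [n]` is identified with `[m * n]` by the
inverse lexicographical order; it is the base point if `x` or `y` is. -/
def pair {m n : ℕ} (x : Fin (m + 1)) (y : Fin (n + 1)) : Fin (m * n + 1) :=
  Fin.cases 0 (fun i => Fin.cases 0 (fun j => (colex m n (i, j)).succ) y) x

@[simp] theorem pair_zero_left {m n : ℕ} (y : Fin (n + 1)) :
    pair (0 : Fin (m + 1)) y = 0 := rfl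

@[simp] theorem pair_zero_right {m n : ℕ} (x : Fin (m + 1)) :
    pair x (0 : Fin (n + 1)) = 0 := by
  cases x using Fin.cases <;> rfl

@[simp] theorem pair_succ {m n : ℕ} (i : Fin m) (j : Fin n) :
    pair i.succ j.succ = (colex m n (i, j)).succ := rfl

/-- The smash product `f ∧ g : [m] ∧ [n] → [m'] ∧ [n']` of pointed maps. -/
def smash {m n m' n' : ℕ} (f : (⟨m⟩ : GammaOp) ⟶ ⟨m'⟩) (g : (⟨n⟩ : GammaOp) ⟶ ⟨n'⟩) :
    (⟨m * n⟩ : GammaOp) ⟶ ⟨m' * n'⟩ where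
  toFun := Fin.cases 0 fun z =>
    pair (f.toFun ((colex m n).symm z).1.succ) (g.toFun ((colex m n).symm z).2.succ)
  map_zero := rfl

theorem smash_pair {m n m' n' : ℕ} (f : (⟨m⟩ : GammaOp) ⟶ ⟨m'⟩) (g : (⟨n⟩ : GammaOp) ⟶ ⟨n'⟩)
    (x : Fin (m + 1)) (y : Fin (n + 1)) :
    (smash f g).toFun (pair x y) = pair (f.toFun x) (g.toFun y) := by
  have hf : f.toFun (0 : Fin (m + 1)) = 0 := f.map_zero
  have hg : g.toFun (0 : Fin (n + 1)) = 0 := g.map_zero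
  cases x using Fin.cases with
  | zero =>
    rw [pair_zero_left, hf]
    exact (smash f g).map_zero.trans (pair_zero_left _).symm
  | succ i =>
    cases y using Fin.cases with
    | zero =>
      rw [pair_zero_right, hg]
      exact (smash f g).map_zero.trans (pair_zero_right _).symm
    | succ j => simp [smash]

/-- `y ↦ x ∧ y`, as a map `[n] → [m] ∧ [n]`. -/
def pairLeft {m n : ℕ} (x : Fin (m + 1)) : (⟨n⟩ : GammaOp) ⟶ ⟨m * n⟩ where
  toFun y := pair x y
  map_zero := pair_zero_right x

/-- `x ↦ x ∧ y`, as a map `[m] → [m] ∧ [n]`. -/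
def pairRight {m n : ℕ} (y : Fin (n + 1)) : (⟨m⟩ : GammaOp) ⟶ ⟨m * n⟩ where
  toFun x := pair x y
  map_zero := pair_zero_left y

/-- The associativity `([m] ∧ [n]) ∧ [p] → [m] ∧ ([n] ∧ [p])`; with the inverse lexicographical
order it is the identity on the labels. -/
def assocMap (m n p : ℕ) : (⟨m * n * p⟩ : GammaOp) ⟶ ⟨m * (n * p)⟩ where
  toFun := Fin.cast (by rw [Nat.mul_assoc])
  map_zero := rfl

theorem assocMap_pair {m n p : ℕ} (x : Fin (m + 1)) (y : Fin (n + 1)) (z : Fin (p + 1)) :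
    (assocMap m n p).toFun (pair (pair x y) z) = pair x (pair y z) := by
  cases x using Fin.cases with
  | zero => rfl
  | succ i =>
    cases y using Fin.cases with
    | zero => rfl
    | succ j =>
      cases z using Fin.cases with
      | zero => rfl
      | succ k =>
        apply Fin.ext
        simp only [assocMap, pair_succ, Fin.val_cast, Fin.val_succ, colex_val]
        ring

/-! ### Γ-rings -/

/-- A unit and a multiplication on a functor from `Γᵒᵖ` to pointed sets. The unit is a natural
transformation from the inclusion `𝐒 : [n] ↦ [n]`; the multiplication `F ∧ F → F` is given, through
the universal property of the smash product, by maps `F[m] ∧ F[n] → F([m] ∧ [n])`, natural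
in `[m]` and `[n]`, that is, by maps of two variables which send pairs with a base point to the base
point. -/
structure MulStr (F : GammaOp ⥤ Pointed.{u}) where
  /-- the unit `η : 𝐒 → F` -/
  unit : ∀ n : ℕ, Fin (n + 1) → F.obj ⟨n⟩
  /-- the multiplication `F[m] ∧ F[n] → F([m] ∧ [n])` -/
  mul : ∀ {m n : ℕ}, F.obj ⟨m⟩ → F.obj ⟨n⟩ → F.obj ⟨m * n⟩
  unit_zero : ∀ n, unit n 0 = (F.obj ⟨n⟩).point
  unit_natural : ∀ {m n : ℕ} (f : (⟨m⟩ : GammaOp) ⟶ ⟨n⟩) (x : Fin (m + 1)),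
    (F.map f).toFun (unit m x) = unit n (f.toFun x)
  zero_mul : ∀ {m n : ℕ} (b : F.obj ⟨n⟩),
    mul (F.obj ⟨m⟩).point b = (F.obj ⟨m * n⟩).point
  mul_zero : ∀ {m n : ℕ} (a : F.obj ⟨m⟩),
    mul a (F.obj ⟨n⟩).point = (F.obj ⟨m * n⟩).point
  mul_natural : ∀ {m n m' n' : ℕ} (f : (⟨m⟩ : GammaOp) ⟶ ⟨m'⟩) (g : (⟨n⟩ : GammaOp) ⟶ ⟨n'⟩)
    (a : F.obj ⟨m⟩) (b : F.obj ⟨n⟩),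
    (F.map (smash f g)).toFun (mul a b) = mul ((F.map f).toFun a) ((F.map g).toFun b)
  mul_assoc : ∀ {m n p : ℕ} (a : F.obj ⟨m⟩) (b : F.obj ⟨n⟩) (c : F.obj ⟨p⟩),
    (F.map (assocMap m n p)).toFun (mul (mul a b) c) = mul a (mul b c)
  /-- `𝐒 ∧ F → F ∧ F → F` is the canonical isomorphism -/
  unit_mul : ∀ {m n : ℕ} (x : Fin (m + 1)) (b : F.obj ⟨n⟩),
    mul (unit m x) b = (F.map (pairLeft x)).toFun b
  /-- `F ∧ 𝐒 → F ∧ F → F` is the canonical isomorphism -/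
  mul_unit : ∀ {m n : ℕ} (a : F.obj ⟨m⟩) (y : Fin (n + 1)),
    mul a (unit n y) = (F.map (pairRight y)).toFun a

/-- A discrete Γ-ring: all the simplicial sets `R[n]` are sets. -/
structure DiscreteGammaRing : Type (u + 1) where
  /-- the underlying Γ-space -/
  space : GammaOp ⥤ Pointed.{u}
  /-- `R[0]` is a point -/
  subsingleton_zero : Subsingleton (space.obj ⟨0⟩)
  /-- unit and multiplication -/
  ring : MulStr space

namespace DiscreteGammaRing

variable (A : DiscreteGammaRing.{u})

/-- The set `A[n]`. -/
abbrev El (n : ℕ) : Type u := A.space.obj ⟨n⟩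

/-- The base point `0` of `A[n]`. -/
def zero (n : ℕ) : A.El n := (A.space.obj ⟨n⟩).point

/-- The unit `1` of the monoid `A[1]`: the image of `1 ∈ 𝐒[1]`. -/
def one : A.El 1 := A.ring.unit 1 1

/-- The map `A[m] → A[n]` induced by a pointed map `[m] → [n]`. -/
def act {m n : ℕ} (f : (⟨m⟩ : GammaOp) ⟶ ⟨n⟩) (a : A.El m) : A.El n := (A.space.map f).toFun a

/-- The product `ab ∈ A([m] ∧ [n]) = A[m * n]`. -/
def mul {m n : ℕ} (a : A.El m) (b : A.El n) : A.El (m * n) := A.ring.mul a b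

/-- The power `r ^ k ∈ A[2 ^ k]` of an element `r ∈ A[2]`. -/
def pow (r : A.El 2) : (k : ℕ) → A.El (2 ^ k)
  | 0 => A.one
  | k + 1 => A.mul (pow r k) r

end DiscreteGammaRing

/-- Multiplicative maps `A → B`: maps of Γ-spaces that respect unit and multiplication. -/
@[ext]
structure MultMap (A : DiscreteGammaRing.{v}) (B : DiscreteGammaRing.{w}) : Type (max v w) where
  /-- the map `A[n] → B[n]` -/
  toFun : ∀ n : ℕ, A.El n → B.El n
  map_point : ∀ n, toFun n (A.zero n) = B.zero n
  natural : ∀ {m n : ℕ} (f : (⟨m⟩ : GammaOp) ⟶ ⟨n⟩) (a : A.El m),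
    toFun n (A.act f a) = B.act f (toFun m a)
  map_unit : ∀ n (x : Fin (n + 1)), toFun n (A.ring.unit n x) = B.ring.unit n x
  map_mul : ∀ {m n : ℕ} (a : A.El m) (b : A.El n),
    toFun (m * n) (A.mul a b) = B.mul (toFun m a) (toFun n b)

namespace MultMap

/-- The identity. -/
def id (A : DiscreteGammaRing.{u}) : MultMap A A where
  toFun _ a := a
  map_point _ := rfl
  natural _ _ := rfl
  map_unit _ _ := rfl
  map_mul _ _ := rfl

/-- Composition, in diagrammatic order. -/
def comp {A : DiscreteGammaRing.{u}} {B : DiscreteGammaRing.{v}} {C : DiscreteGammaRing.{w}}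
    (φ : MultMap A B) (ψ : MultMap B C) : MultMap A C where
  toFun n a := ψ.toFun n (φ.toFun n a)
  map_point n := by rw [φ.map_point, ψ.map_point]
  natural f a := by rw [φ.natural, ψ.natural]
  map_unit n x := by rw [φ.map_unit, ψ.map_unit]
  map_mul a b := by rw [φ.map_mul, ψ.map_mul]

end MultMap

instance : Category DiscreteGammaRing.{u} where
  Hom := MultMap
  id := MultMap.id
  comp := MultMap.comp

/-- The degree `d` part of a functor from `Γᵒᵖ` to pointed simplicial sets. -/
def levelSpace (X : GammaOp ⥤ SimplicialObject Pointed.{u}) (d : SimplexCategoryᵒᵖ) :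
    GammaOp ⥤ Pointed.{u} where
  obj n := (X.obj n).obj d
  map f := (X.map f).app d
  map_id n := by rw [X.map_id]; rfl
  map_comp f g := by rw [X.map_comp]; rfl

/-- A Γ-ring: a functor from `Γᵒᵖ` to pointed simplicial sets with `R[0] = [0]`, with a unit
`𝐒 → R` and a multiplication given by maps of pointed simplicial sets
`R[m] ∧ R[n] → R([m] ∧ [n])`; these consist of maps in each simplicial degree which commute with the
simplicial operators, and the axioms are equations in each degree. -/
structure GammaRing : Type (u + 1) where
  /-- the underlying Γ-space -/
  space : GammaOp ⥤ SimplicialObject Pointed.{u}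
  /-- `R[0]` is a point -/
  subsingleton_zero : ∀ d, Subsingleton ((space.obj ⟨0⟩).obj d)
  /-- unit and multiplication, in each simplicial degree -/
  ring : ∀ d, MulStr (levelSpace space d)
  unit_simplicial : ∀ {d e : SimplexCategoryᵒᵖ} (θ : d ⟶ e) (n : ℕ) (x : Fin (n + 1)),
    ((space.obj ⟨n⟩).map θ).toFun ((ring d).unit n x) = (ring e).unit n x
  mul_simplicial : ∀ {d e : SimplexCategoryᵒᵖ} (θ : d ⟶ e) {m n : ℕ}
    (a : (space.obj ⟨m⟩).obj d) (b : (space.obj ⟨n⟩).obj d),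
    ((space.obj ⟨m * n⟩).map θ).toFun ((ring d).mul a b) =
      (ring e).mul (((space.obj ⟨m⟩).map θ).toFun a) (((space.obj ⟨n⟩).map θ).toFun b)

namespace GammaRing

/-- The discrete Γ-ring `R_d` formed by the simplices of degree `d`. -/
def level (R : GammaRing.{u}) (d : SimplexCategoryᵒᵖ) : DiscreteGammaRing.{u} where
  space := levelSpace R.space d
  subsingleton_zero := R.subsingleton_zero d
  ring := R.ring d

/-- A simplicial operator induces a multiplicative map `R_d → R_e`. -/
def levelMap (R : GammaRing.{u}) {d e : SimplexCategoryᵒᵖ} (θ : d ⟶ e) :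
    R.level d ⟶ R.level e where
  toFun n a := ((R.space.obj ⟨n⟩).map θ).toFun a
  map_point n := ((R.space.obj ⟨n⟩).map θ).map_point
  natural f a := (congrFun (congrArg Pointed.Hom.toFun ((R.space.map f).naturality θ)) a).symm
  map_unit n x := R.unit_simplicial θ n x
  map_mul a b := R.mul_simplicial θ a b

/-- The simplicial discrete Γ-ring `d ↦ R_d`. -/
def levels (R : GammaRing.{u}) : SimplicialObject DiscreteGammaRing.{u} where
  obj := R.level
  map θ := R.levelMap θ
  map_id d := by
    apply MultMap.ext
    funext n a
    exact congrFun (congrArg Pointed.Hom.toFun ((R.space.obj ⟨n⟩).map_id d)) a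
  map_comp θ θ' := by
    apply MultMap.ext
    funext n a
    exact congrFun (congrArg Pointed.Hom.toFun ((R.space.obj ⟨n⟩).map_comp θ θ')) a

/-- Maps of Γ-rings: maps of Γ-spaces that respect unit and multiplication. -/
@[ext]
structure Hom (R R' : GammaRing.{u}) : Type u where
  /-- the underlying map of Γ-spaces -/
  nat : R.space ⟶ R'.space
  map_unit : ∀ d n (x : Fin (n + 1)),
    ((nat.app ⟨n⟩).app d).toFun ((R.ring d).unit n x) = (R'.ring d).unit n x
  map_mul : ∀ d {m n : ℕ} (a : (R.space.obj ⟨m⟩).obj d) (b : (R.space.obj ⟨n⟩).obj d),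
    ((nat.app ⟨m * n⟩).app d).toFun ((R.ring d).mul a b) =
      (R'.ring d).mul (((nat.app ⟨m⟩).app d).toFun a) (((nat.app ⟨n⟩).app d).toFun b)

instance : Category GammaRing.{u} where
  Hom := Hom
  id R := ⟨𝟙 R.space, fun _ _ _ => rfl, fun _ _ _ _ _ => rfl⟩
  comp f g := ⟨f.nat ≫ g.nat,
    fun d n x => (congrArg ((g.nat.app ⟨n⟩).app d).toFun (f.map_unit d n x)).trans
      (g.map_unit d n x),
    fun d m n a b => (congrArg ((g.nat.app ⟨m * n⟩).app d).toFun (f.map_mul d a b)).trans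
      (g.map_mul d _ _)⟩

/-- The multiplicative map `R_d → R'_d` induced by a map `R → R'` of Γ-rings. -/
def Hom.level {R R' : GammaRing.{u}} (f : R ⟶ R') (d : SimplexCategoryᵒᵖ) :
    R.level d ⟶ R'.level d where
  toFun n a := ((f.nat.app ⟨n⟩).app d).toFun a
  map_point n := ((f.nat.app ⟨n⟩).app d).map_point
  natural g a := congrFun (congrArg Pointed.Hom.toFun
    (congrFun (congrArg NatTrans.app (f.nat.naturality g)) d)) a
  map_unit n x := f.map_unit d n x
  map_mul a b := f.map_mul d a b

/-- `R ↦ (d ↦ R_d)` as a functor. -/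
def levelsFunctor : GammaRing.{u} ⥤ SimplicialObject DiscreteGammaRing.{u} where
  obj := levels
  map f :=
    { app := fun d => Hom.level f d
      naturality := fun d e θ => by
        apply MultMap.ext
        funext n a
        exact congrFun (congrArg Pointed.Hom.toFun ((f.nat.app ⟨n⟩).naturality θ)) a }
  map_id _ := rfl
  map_comp _ _ := rfl

end GammaRing

/-! ### The Eilenberg–MacLane Γ-ring `Hℤ` -/

/-- The map `ℤᵐ → ℤⁿ` of reduced free abelian groups induced by a pointed map `[m] → [n]`:
coordinates are added along the map, those sent to the base point are dropped. -/
def HZmap {m n : GammaOp} (f : m ⟶ n) (a : Fin m.card → ℤ) (k : Fin n.card) : ℤ :=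
  ∑ j : Fin m.card, if f.toFun j.succ = k.succ then a j else 0

theorem sum_ite_succ {n : ℕ} (y : Fin (n + 1)) (h : Fin (n + 1) → ℤ) (h0 : h 0 = 0) :
    (∑ i : Fin n, if y = i.succ then h i.succ else 0) = h y := by
  cases y using Fin.cases with
  | zero => simp [(Fin.succ_ne_zero _).symm, h0]
  | succ i => simp [Fin.succ_inj]

/-- The functor `[n] ↦ ℤ̃[n]`, the reduced free abelian group on the pointed set `[n]`, an element
being the tuple `(a₁, …, aₙ)` of its coordinates. -/
def HZspace : GammaOp ⥤ Pointed.{0} where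
  obj n := Pointed.of (0 : Fin n.card → ℤ)
  map f := ⟨HZmap f, by funext k; simp [HZmap]⟩
  map_id n := by
    apply Pointed.Hom.ext
    funext a k
    simp [HZmap, Fin.succ_inj]
  map_comp {m n p} f g := by
    apply Pointed.Hom.ext
    funext a k
    change HZmap (f ≫ g) a k = HZmap g (HZmap f a) k
    have hg : g.toFun 0 = 0 := g.map_zero
    simp only [HZmap, comp_toFun, Function.comp_apply]
    have h1 : ∀ i : Fin n.card,
        (if g.toFun i.succ = k.succ then
          ∑ j : Fin m.card, (if f.toFun j.succ = i.succ then a j else 0) else 0) =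
        ∑ j : Fin m.card, if f.toFun j.succ = i.succ then
          (if g.toFun i.succ = k.succ then a j else 0) else 0 := by
      intro i
      split_ifs <;> simp
    rw [Finset.sum_congr rfl fun i _ => h1 i, Finset.sum_comm]
    refine Finset.sum_congr rfl fun j _ => ?_
    exact (sum_ite_succ (f.toFun j.succ) (fun y => if g.toFun y = k.succ then a j else 0)
      (by simp [hg, (Fin.succ_ne_zero _).symm])).symm

/-- The embedding of the generators, `[n] → ℤ̃[n]`. -/
def HZunit (n : ℕ) (x : Fin (n + 1)) (k : Fin n) : ℤ := if x = k.succ then 1 else 0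

/-- The multiplication `ℤ̃[m] ∧ ℤ̃[n] → ℤ̃([m] ∧ [n])`: the coordinate of the product at `i ∧ j` is
the product of the coordinates at `i` and `j`. -/
def HZmul {m n : ℕ} (a : Fin m → ℤ) (b : Fin n → ℤ) (z : Fin (m * n)) : ℤ :=
  a ((colex m n).symm z).1 * b ((colex m n).symm z).2

theorem HZmul_colex {m n : ℕ} (a : Fin m → ℤ) (b : Fin n → ℤ) (i : Fin m) (j : Fin n) :
    HZmul a b (colex m n (i, j)) = a i * b j := by
  simp [HZmul]

theorem pair_eq_succ {m n : ℕ} (x : Fin (m + 1)) (y : Fin (n + 1)) (i : Fin m) (j : Fin n) :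
    pair x y = (colex m n (i, j)).succ ↔ x = i.succ ∧ y = j.succ := by
  cases x using Fin.cases with
  | zero => simp [(Fin.succ_ne_zero _).symm]
  | succ i' =>
    cases y using Fin.cases with
    | zero => simp [(Fin.succ_ne_zero _).symm]
    | succ j' => simp [Fin.succ_inj]

theorem HZmul_natural {m n m' n' : ℕ} (f : (⟨m⟩ : GammaOp) ⟶ ⟨m'⟩) (g : (⟨n⟩ : GammaOp) ⟶ ⟨n'⟩)
    (a : Fin m → ℤ) (b : Fin n → ℤ) :
    HZmap (smash f g) (HZmul a b) = HZmul (HZmap f a) (HZmap g b) := by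
  funext z
  obtain ⟨⟨i', j'⟩, rfl⟩ := (colex m' n').surjective z
  rw [HZmul_colex]
  simp only [HZmap]
  rw [← (colex m n).sum_comp, Finset.sum_mul_sum, Fintype.sum_prod_type]
  refine Finset.sum_congr rfl fun i _ => Finset.sum_congr rfl fun j _ => ?_
  rw [← pair_succ, smash_pair, HZmul_colex]
  simp only [pair_eq_succ]
  split_ifs <;> simp_all

theorem HZmul_assoc {m n p : ℕ} (a : Fin m → ℤ) (b : Fin n → ℤ) (c : Fin p → ℤ) :
    HZmap (assocMap m n p) (HZmul (HZmul a b) c) = HZmul a (HZmul b c) := by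
  funext z
  obtain ⟨⟨i, t⟩, rfl⟩ := (colex m (n * p)).surjective z
  obtain ⟨⟨j, k⟩, rfl⟩ := (colex n p).surjective t
  have h : (colex m (n * p) (i, colex n p (j, k))).succ =
      (assocMap m n p).toFun (colex (m * n) p (colex m n (i, j), k)).succ :=
    (assocMap_pair i.succ j.succ k.succ).symm
  have hinj : Function.Injective (assocMap m n p).toFun :=
    Fin.cast_injective (by simp only [Nat.mul_assoc])
  rw [HZmul_colex, HZmul_colex]
  simp only [HZmap, h, hinj.eq_iff, Fin.succ_inj]
  rw [Finset.sum_ite_eq' Finset.univ, if_pos (Finset.mem_univ _), HZmul_colex, HZmul_colex]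
  ring

theorem HZunit_mul {m n : ℕ} (x : Fin (m + 1)) (b : Fin n → ℤ) :
    HZmul (HZunit m x) b = HZmap (pairLeft x) b := by
  funext z
  obtain ⟨⟨i, j⟩, rfl⟩ := (colex m n).surjective z
  rw [HZmul_colex]
  simp only [HZmap, HZunit, pairLeft, pair_eq_succ, Fin.succ_inj]
  by_cases h : x = i.succ <;> simp [h]

theorem HZmul_unit {m n : ℕ} (a : Fin m → ℤ) (y : Fin (n + 1)) :
    HZmul a (HZunit n y) = HZmap (pairRight y) a := by
  funext z
  obtain ⟨⟨i, j⟩, rfl⟩ := (colex m n).surjective z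
  rw [HZmul_colex]
  simp only [HZmap, HZunit, pairRight, pair_eq_succ, Fin.succ_inj]
  by_cases h : y = j.succ <;> simp [h]

/-- The Γ-ring `Hℤ`. -/
def HZ : DiscreteGammaRing.{0} where
  space := HZspace
  subsingleton_zero := inferInstanceAs (Subsingleton (Fin 0 → ℤ))
  ring :=
    { unit := HZunit
      mul := HZmul
      unit_zero := fun n => by
        funext k
        exact if_neg (Fin.succ_ne_zero k).symm
      unit_natural := fun {m n} f x => by
        funext k
        have hf : f.toFun (0 : Fin (m + 1)) = 0 := f.map_zero
        change HZmap f (HZunit m x) k = HZunit n (f.toFun x) k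
        simp only [HZmap, HZunit]
        rw [← sum_ite_succ x (fun y => if f.toFun y = k.succ then (1 : ℤ) else 0)
          (by simp [hf, (Fin.succ_ne_zero _).symm])]
        refine Finset.sum_congr rfl fun j _ => ?_
        split_ifs <;> rfl
      zero_mul := fun b => by
        funext z
        exact Int.zero_mul _
      mul_zero := fun a => by
        funext z
        exact Int.mul_zero _
      mul_natural := HZmul_natural
      mul_assoc := HZmul_assoc
      unit_mul := HZunit_mul
      mul_unit := HZmul_unit }

/-! ### Formal difference laws -/

/-- The restriction `p_i : [n] → [n - 1]`: `i` goes to `0`, the order of the rest is preserved. -/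
def restr (n i : ℕ) (hi : 1 ≤ i ∧ i ≤ n) : (⟨n⟩ : GammaOp) ⟶ ⟨n - 1⟩ where
  toFun a :=
    if h : a.1 < i then ⟨a.1, by dsimp only; omega⟩
    else if a.1 = i then 0
    else ⟨a.1 - 1, by have := a.2; dsimp only at *; omega⟩
  map_zero := dif_pos hi.1

/-- The injection `d_j : [n - 1] → [n]` which misses `j` and preserves the order. -/
def skip (n j : ℕ) (hj : 1 ≤ j ∧ j ≤ n) : (⟨n - 1⟩ : GammaOp) ⟶ ⟨n⟩ where
  toFun a := if a.1 < j then ⟨a.1, by have := a.2; dsimp only at *; omega⟩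
    else ⟨a.1 + 1, by have := a.2; dsimp only at *; omega⟩
  map_zero := if_pos hj.1

/-- The summing map `s_{i,j,l} : [n] → [n - 1]`: `i` and `j` go to `l`, and the other elements are
mapped bijectively onto `[n - 1] \ {l}`, preserving the order (`b` below is the position of `a`
in `[n] \ {i, j}`, counted from `0`). -/
def fold (n i j l : ℕ) (hij : 1 ≤ i ∧ i < j ∧ j ≤ n) (hl : 1 ≤ l ∧ l ≤ n - 1) :
    (⟨n⟩ : GammaOp) ⟶ ⟨n - 1⟩ where
  toFun a :=
    if h : a.1 = i ∨ a.1 = j then ⟨l, by dsimp only; omega⟩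
    else
      let b := if a.1 < i then a.1 else if a.1 < j then a.1 - 1 else a.1 - 2
      ⟨if b < l then b else b + 1, by
        have := a.2
        dsimp only [b] at *
        split_ifs <;> omega⟩
  map_zero := by
    have h0 : ((0 : Fin (n + 1)) : ℕ) = 0 := rfl
    apply Fin.ext
    simp only [Fin.val_zero]
    split_ifs <;> simp_all <;> omega

/-- The transposition of `1` and `2` in `[2]`. -/
def swap : (⟨2⟩ : GammaOp) ⟶ ⟨2⟩ where
  toFun := Equiv.swap 1 2
  map_zero := rfl

/-- The subset `A₊` of `{1, …, 2 ^ k}`: the binary expansion of `i - 1` has an even number of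
digits `1`. The other elements form `A₋`. -/
def InAplus (i : ℕ) : Prop := Even ((Nat.digits 2 (i - 1)).count 1)

/-- A permutation of `[n]` that fixes the base point, as a map in `Γᵒᵖ`. -/
def permMap {n : ℕ} (π : Equiv.Perm (Fin (n + 1))) (hπ : π 0 = 0) :
    (⟨n⟩ : GammaOp) ⟶ ⟨n⟩ where
  toFun := π
  map_zero := hπ

open DiscreteGammaRing in
/-- Formal difference laws in a discrete Γ-ring `A`. Here `[2] = [1] ∧ [2] = [2] ∧ [1]`. -/
structure IsFormalDifferenceLaw (A : DiscreteGammaRing.{u}) (r : A.El 2) : Prop where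
  /-- `p₂(r) = 1` -/
  restr_two : A.act (restr 2 2 (by decide)) r = A.one
  /-- `s_{1,2,1}(r) = 0` -/
  fold_one_two : A.act (fold 2 1 2 1 (by decide) (by decide)) r = A.zero 1
  /-- `p₁(r) r = σ(r)` -/
  neg_mul : (A.mul (A.act (restr 2 1 (by decide)) r : A.El 1) r : A.El (1 * 2)) = A.act swap r
  /-- `r p₁(r) = σ(r)` -/
  mul_neg : (A.mul r (A.act (restr 2 1 (by decide)) r : A.El 1) : A.El (2 * 1)) = A.act swap r
  /-- `r ^ k` is fixed by the permutations of `[2 ^ k]` that preserve `A₊` and `A₋` -/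
  symm : ∀ (k : ℕ) (π : Equiv.Perm (Fin (2 ^ k + 1))) (hπ : π 0 = 0),
    (∀ i, i ≠ 0 → (InAplus (π i) ↔ InAplus i)) → A.act (permMap π hπ) (A.pow r k) = A.pow r k
  /-- `s_{i,j,l}(r ^ k) = d_l p_i p_j (r ^ k)` if one of `i < j` is in `A₊`, the other in `A₋` -/
  cancel : ∀ (k i j l : ℕ) (hij : 1 ≤ i ∧ i < j ∧ j ≤ 2 ^ k) (hl : 1 ≤ l ∧ l ≤ 2 ^ k - 1),
    ((InAplus i ∧ ¬ InAplus j) ∨ (InAplus j ∧ ¬ InAplus i)) →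
    A.act (fold (2 ^ k) i j l hij hl) (A.pow r k) =
      A.act (skip (2 ^ k - 1) l hl) (A.act (restr (2 ^ k - 1) i (by omega))
        (A.act (restr (2 ^ k) j (by omega)) (A.pow r k)))

theorem MultMap.map_pow {A : DiscreteGammaRing.{u}} {B : DiscreteGammaRing.{v}} (φ : MultMap A B)
    (r : A.El 2) (k : ℕ) : φ.toFun (2 ^ k) (A.pow r k) = B.pow (φ.toFun 2 r) k := by
  induction k with
  | zero => exact φ.map_unit 1 1
  | succ k ih =>
    refine (φ.map_mul (A.pow r k) r).trans ?_
    rw [ih]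
    rfl

/-- Multiplicative maps preserve formal difference laws. -/
theorem IsFormalDifferenceLaw.map {A : DiscreteGammaRing.{u}} {B : DiscreteGammaRing.{v}}
    (φ : MultMap A B) {r : A.El 2} (h : IsFormalDifferenceLaw A r) :
    IsFormalDifferenceLaw B (φ.toFun 2 r) where
  restr_two := by
    rw [← φ.natural, h.restr_two]
    exact φ.map_unit 1 1
  fold_one_two := by
    rw [← φ.natural, h.fold_one_two]
    exact φ.map_point 1
  neg_mul := by
    rw [← φ.natural, ← φ.natural, ← h.neg_mul]
    exact (φ.map_mul (A.act (restr 2 1 (by decide)) r : A.El 1) r).symm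
  mul_neg := by
    rw [← φ.natural, ← φ.natural, ← h.mul_neg]
    exact (φ.map_mul r (A.act (restr 2 1 (by decide)) r : A.El 1)).symm
  symm k π hπ hp := by
    rw [← φ.map_pow, ← φ.natural, h.symm k π hπ hp]
  cancel k i j l hij hl hA := by
    rw [← φ.map_pow, ← φ.natural, ← φ.natural, ← φ.natural, ← φ.natural,
      h.cancel k i j l hij hl hA]

/-- The set of formal difference laws in a discrete Γ-ring, as a functor. -/
def FDLSet : DiscreteGammaRing.{u} ⥤ Type u where
  obj A := {r : A.El 2 // IsFormalDifferenceLaw A r}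
  map φ := ↾fun r => ⟨φ.toFun 2 r.1, r.2.map φ⟩

/-- The set of multiplicative maps from `Hℤ` to a discrete Γ-ring, as a functor. -/
def HZMapSet : DiscreteGammaRing.{u} ⥤ Type u where
  obj A := MultMap HZ A
  map ψ := ↾fun φ => φ.comp ψ

/-- The simplicial set `FDL(R)` of formal difference laws in a Γ-ring `R`, whose degree `d` part is
the set of formal difference laws in `R_d`, as a functor of `R`. -/
def FDL : GammaRing.{u} ⥤ SSet.{u} :=
  GammaRing.levelsFunctor ⋙ (SimplicialObject.whiskering _ _).obj FDLSet

/-- The simplicial set `Γ(Hℤ, R)`, whose degree `d` part is the set of multiplicative maps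
`Hℤ → R_d`, as a functor of `R`. -/
def HZMaps : GammaRing.{u} ⥤ SSet.{u} :=
  GammaRing.levelsFunctor ⋙ (SimplicialObject.whiskering _ _).obj HZMapSet

/-- The set of `d`-simplices of `Γ(Hℤ, R)` is the set of multiplicative maps `Hℤ → R_d`. -/
theorem HZMaps_obj (R : GammaRing.{u}) (d : SimplexCategoryᵒᵖ) :
    (HZMaps.obj R).obj d = MultMap HZ (R.level d) := rfl

/-- The element `(1, -1)` of `Hℤ[2] = ℤ̃[2]`. -/
def plusMinusOne : HZ.El 2 := (![1, -1] : Fin 2 → ℤ)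

/-- The element of `R_d[2]` underlying a `d`-simplex of `FDL(R)`. -/
def FDL.elt {R : GammaRing.{u}} {d : SimplexCategoryᵒᵖ} (r : (FDL.obj R).obj d) :
    (R.level d).El 2 := Subtype.val r

/-- A `d`-simplex of `Γ(Hℤ, R)`, as a multiplicative map. -/
def HZMaps.toMultMap {R : GammaRing.{u}} {d : SimplexCategoryᵒᵖ} (φ : (HZMaps.obj R).obj d) :
    MultMap HZ (R.level d) := φ

end GammaSp

namespace GammaSp

/-! ### Pointed maps -/

/-! The element `(1, -1)` generates `HZ`: its `k`-th power is the sign vector of `A₊` and `A₋`, and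
every `a ∈ ℤⁿ` is the image `f_* (1, -1)^k` of such a power under a pointed map `f`
(`exists_act_pow_plusMinusOne`). A multiplicative map commutes with `f_*` and with powers, so it is
determined by its value at `(1, -1)`, and that value is a formal difference law because `(1, -1)` is
one.

Conversely, a law `r` forces the definition `f_* (1, -1)^k ↦ f_* r^k`. The main point is that this
is well defined (`act_pow_eq`). Since `p₂(r) = 1`, the power `r^k` is an image of `r^(k+m)`, so two
presentations may be given the same exponent. By the cancellation axiom, two elements of opposite
sign in one fibre of `f` may be sent to the base point; repeating this makes every fibre off the
base point consist of one sign only (`exists_isPure`). The coordinates of the image then determine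
how many elements of each sign lie in each fibre, so two such maps differ by a permutation
preserving signs, and the symmetry axiom applies (`act_pow_eq_of_isPure`).

Multiplicativity follows from `f_* r^k · g_* r^l = (f ∧ g)_* r^(k+l)`. The resulting bijection is
natural in the discrete Γ-ring, so it can be applied in each simplicial degree. -/

theorem hom_ext {m n : GammaOp} {f g : m ⟶ n}
    (h : ∀ i : Fin m.card, f.toFun i.succ = g.toFun i.succ) : f = g := by
  apply GammaOp.Hom.ext
  funext x
  cases x using Fin.cases with
  | zero => exact f.map_zero.trans g.map_zero.symm
  | succ i => exact h i

theorem hom_ext_pair {m n : ℕ} {p : GammaOp} {f g : (⟨m * n⟩ : GammaOp) ⟶ p}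
    (h : ∀ (x : Fin (m + 1)) (y : Fin (n + 1)), f.toFun (pair x y) = g.toFun (pair x y)) :
    f = g := by
  apply hom_ext
  intro z
  obtain ⟨⟨i, j⟩, rfl⟩ := (colex m n).surjective z
  exact h i.succ j.succ

/-- The pointed map `[n] → [p]` with prescribed values on the elements different from `0`. -/
def homOf {n p : ℕ} (f : Fin n → Fin (p + 1)) : (⟨n⟩ : GammaOp) ⟶ ⟨p⟩ where
  toFun := Fin.cases 0 f
  map_zero := rfl

@[simp] theorem homOf_succ {n p : ℕ} (f : Fin n → Fin (p + 1)) (i : Fin n) :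
    (homOf f).toFun i.succ = f i := rfl

/-- The identity `[m] → [n]` for `m = n`. -/
def castMap {m n : ℕ} (h : m = n) : (⟨m⟩ : GammaOp) ⟶ ⟨n⟩ where
  toFun := Fin.cast (by rw [h])
  map_zero := rfl

theorem pairRight_castMap {m : ℕ} (h : m * 1 = m) :
    pairRight (1 : Fin (1 + 1)) ≫ castMap h = 𝟙 (⟨m⟩ : GammaOp) := by
  apply hom_ext
  intro i
  apply Fin.ext
  change ((pair i.succ (0 : Fin 1).succ : Fin (m * 1 + 1)) : ℕ) = _
  rw [pair_succ, Fin.val_succ, colex_val]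
  rfl

theorem pairLeft_castMap {m : ℕ} (h : 1 * m = m) :
    pairLeft (1 : Fin (1 + 1)) ≫ castMap h = 𝟙 (⟨m⟩ : GammaOp) := by
  apply hom_ext
  intro i
  apply Fin.ext
  change ((pair (0 : Fin 1).succ i.succ : Fin (1 * m + 1)) : ℕ) = _
  rw [pair_succ, Fin.val_succ, colex_val]
  simp

theorem smash_id (m n : ℕ) : smash (𝟙 (⟨m⟩ : GammaOp)) (𝟙 (⟨n⟩ : GammaOp)) = 𝟙 _ := by
  apply hom_ext_pair
  intro x y
  rw [smash_pair]
  rfl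

theorem smash_castMap {m m' n : ℕ} (h : m = m') (h' : m * n = m' * n) :
    smash (castMap h) (𝟙 (⟨n⟩ : GammaOp)) = castMap h' := by
  subst h
  exact smash_id m n

/-! ### Functoriality, and powers of an element of `A[2]` -/

namespace DiscreteGammaRing

variable (A : DiscreteGammaRing.{u})

@[simp] theorem act_id {n : ℕ} (a : A.El n) : A.act (𝟙 (⟨n⟩ : GammaOp)) a = a :=
  congrFun (congrArg Pointed.Hom.toFun (A.space.map_id ⟨n⟩)) a

theorem act_comp {m n p : ℕ} (f : (⟨m⟩ : GammaOp) ⟶ ⟨n⟩) (g : (⟨n⟩ : GammaOp) ⟶ ⟨p⟩)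
    (a : A.El m) : A.act (f ≫ g) a = A.act g (A.act f a) :=
  congrFun (congrArg Pointed.Hom.toFun (A.space.map_comp f g)) a

theorem act_smash {m n m' n' : ℕ} (f : (⟨m⟩ : GammaOp) ⟶ ⟨m'⟩) (g : (⟨n⟩ : GammaOp) ⟶ ⟨n'⟩)
    (a : A.El m) (b : A.El n) :
    A.act (smash f g) (A.mul a b) = A.mul (A.act f a) (A.act g b) :=
  A.ring.mul_natural f g a b

theorem act_castMap_mul_one {m : ℕ} (h : m * 1 = m) (a : A.El m) :
    A.act (castMap h) (A.mul a A.one) = a := by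
  have h1 : A.mul a A.one = A.act (pairRight 1) a := A.ring.mul_unit a 1
  rw [h1, ← act_comp, pairRight_castMap, act_id]

theorem act_castMap_one_mul {m : ℕ} (h : 1 * m = m) (a : A.El m) :
    A.act (castMap h) (A.mul A.one a) = a := by
  have h1 : A.mul A.one a = A.act (pairLeft 1) a := A.ring.unit_mul 1 a
  rw [h1, ← act_comp, pairLeft_castMap, act_id]

theorem act_castMap_pow_one (r : A.El 2) : A.act (castMap (by norm_num)) (A.pow r 1) = r :=
  A.act_castMap_one_mul rfl r

theorem act_castMap_pow_mul (r : A.El 2) (k l : ℕ) (h : 2 ^ k * 2 ^ l = 2 ^ (k + l)) :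
    A.act (castMap h) (A.mul (A.pow r k) (A.pow r l)) = A.pow r (k + l) := by
  induction l with
  | zero => exact A.act_castMap_mul_one (m := 2 ^ k) h _
  | succ l ih =>
    have hl : 2 ^ k * 2 ^ l = 2 ^ (k + l) := (pow_add 2 k l).symm
    have h1 : A.act (assocMap (2 ^ k) (2 ^ l) 2) (A.mul (A.mul (A.pow r k) (A.pow r l)) r) =
        A.mul (A.pow r k) (A.pow r (l + 1)) := A.ring.mul_assoc _ _ _
    have h2 : A.mul (A.act (castMap hl) (A.mul (A.pow r k) (A.pow r l))) r =
        A.pow r (k + l + 1) := by rw [ih hl]; rfl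
    rw [← h1]
    refine (A.act_comp (assocMap (2 ^ k) (2 ^ l) 2) (castMap h) _).symm.trans (Eq.trans ?_ h2)
    have h3 := A.act_smash (castMap hl) (𝟙 (⟨2⟩ : GammaOp)) (A.mul (A.pow r k) (A.pow r l)) r
    rw [act_id] at h3
    rw [← h3, smash_castMap hl (by rw [hl])]
    -- The associator and the casts preserve labels, so both composites are the same relabelling.
    rfl

/-- The map `[2 ^ (k + 1)] = [2 ^ k] ∧ [2] → [2 ^ k]` which keeps the first half and sends the second
half to the base point. -/
def halve (k : ℕ) : (⟨2 ^ (k + 1)⟩ : GammaOp) ⟶ ⟨2 ^ k⟩ :=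
  (smash (𝟙 (⟨2 ^ k⟩ : GammaOp)) (restr 2 2 (by decide)) :
    (⟨2 ^ k * 2⟩ : GammaOp) ⟶ ⟨2 ^ k * 1⟩) ≫
    castMap (Nat.mul_one _)

/-- Applying `id ∧ p₂` to `r^k · r` gives `r^k · 1`. This is how different exponents are compared.
-/
theorem act_halve {r : A.El 2} (hr : A.act (restr 2 2 (by decide)) r = A.one) (k : ℕ) :
    A.act (halve k) (A.pow r (k + 1)) = A.pow r k := by
  have h := A.act_smash (𝟙 (⟨2 ^ k⟩ : GammaOp)) (restr 2 2 (by decide)) (A.pow r k) r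
  rw [act_id, hr] at h
  unfold halve
  refine (A.act_comp _ _ _).trans ?_
  refine (congrArg (A.act (castMap (Nat.mul_one (2 ^ k)))) h).trans ?_
  exact A.act_castMap_mul_one _ _

/-- The iterate `[2 ^ (k + m)] → [2 ^ k]` of `halve`. -/
def halves (k : ℕ) : (m : ℕ) → ((⟨2 ^ (k + m)⟩ : GammaOp) ⟶ ⟨2 ^ k⟩)
  | 0 => 𝟙 _
  | m + 1 => halve (k + m) ≫ halves k m

theorem act_halves {r : A.El 2} (hr : A.act (restr 2 2 (by decide)) r = A.one) (k m : ℕ) :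
    A.act (halves k m) (A.pow r (k + m)) = A.pow r k := by
  induction m with
  | zero => exact A.act_id _
  | succ m ih =>
    refine (A.act_comp (halve (k + m)) (halves k m) _).trans ?_
    refine (congrArg (A.act (halves k m)) (A.act_halve hr (k + m))).trans ih

end DiscreteGammaRing

/-! ### Cancelling a pair -/

/-- Both maps enumerate the complement of `{i, j}` in order, leaving a gap at `l`. Hence the two
sides of the cancellation axiom differ only in where `i` and `j` go. As `i < j`, removing `j` first
does not shift `i`. -/
theorem restr_restr_skip (n i j l : ℕ) (hij : 1 ≤ i ∧ i < j ∧ j ≤ n) (hl : 1 ≤ l ∧ l ≤ n - 1)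
    (a : Fin (n + 1)) :
    (restr n j (by omega) ≫ restr (n - 1) i (by omega) ≫ skip (n - 1) l hl).toFun a =
      if a.1 = i ∨ a.1 = j then 0 else (fold n i j l hij hl).toFun a := by
  apply Fin.ext
  simp only [comp_toFun, Function.comp_apply, restr, skip, fold]
  have h0 : ∀ m : ℕ, ((0 : Fin (m + 1)) : ℕ) = 0 := fun _ => rfl
  grind

/-- A section of `fold n i j 1` away from `j`. -/
def unfold (n i j : ℕ) (hij : 1 ≤ i ∧ i < j ∧ j ≤ n) : (⟨n - 1⟩ : GammaOp) ⟶ ⟨n⟩ where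
  toFun b :=
    ⟨if b.1 = 0 then 0 else if b.1 = 1 then i else if b.1 - 1 < i then b.1 - 1
      else if b.1 < j then b.1 else b.1 + 1, by
        have := b.2
        dsimp only at *
        split_ifs <;> omega⟩
  map_zero := rfl

theorem fold_unfold (n i j : ℕ) (hij : 1 ≤ i ∧ i < j ∧ j ≤ n) (a : Fin (n + 1)) :
    ((fold n i j 1 hij (by omega) ≫ unfold n i j hij).toFun a : ℕ) =
      if a.1 = j then i else a.1 := by
  simp only [comp_toFun, Function.comp_apply, fold, unfold]
  grind

/-- Folding and unfolding moves `j` to `i` and fixes the rest, which `f` does not notice. So `f`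
factors through the fold, to which the cancellation axiom applies. -/
theorem fold_unfold_comp {n p i j : ℕ} (hij : 1 ≤ i ∧ i < j ∧ j ≤ n)
    (f : (⟨n⟩ : GammaOp) ⟶ ⟨p⟩)
    (hf : f.toFun (⟨i, by omega⟩ : Fin (n + 1)) =
      f.toFun (⟨j, by omega⟩ : Fin (n + 1))) :
    fold n i j 1 hij (by omega) ≫ unfold n i j hij ≫ f = f := by
  apply GammaOp.Hom.ext
  funext a
  rw [← Category.assoc, comp_toFun, Function.comp_apply]
  by_cases h : a.1 = j
  · rw [show a = (⟨j, by omega⟩ : Fin (n + 1)) from Fin.ext h, ← hf]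
    congr 1
    apply Fin.ext
    rw [fold_unfold]
    simp
  · congr 1
    apply Fin.ext
    rw [fold_unfold, if_neg h]

/-- The map which sends `i` and `j` to the base point and agrees with `f` elsewhere. -/
def kill {n p : ℕ} (f : (⟨n⟩ : GammaOp) ⟶ ⟨p⟩) (i j : ℕ) : (⟨n⟩ : GammaOp) ⟶ ⟨p⟩ where
  toFun a := if a.1 = i ∨ a.1 = j then 0 else f.toFun a
  map_zero := by
    split_ifs
    · rfl
    · exact f.map_zero

theorem restr_restr_skip_unfold {n p i j : ℕ} (hij : 1 ≤ i ∧ i < j ∧ j ≤ n)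
    (f : (⟨n⟩ : GammaOp) ⟶ ⟨p⟩)
    (hf : f.toFun (⟨i, by omega⟩ : Fin (n + 1)) =
      f.toFun (⟨j, by omega⟩ : Fin (n + 1))) :
    restr n j (by omega) ≫ restr (n - 1) i (by omega) ≫ skip (n - 1) 1 (by omega) ≫
      unfold n i j hij ≫ f = kill f i j := by
  apply GammaOp.Hom.ext
  funext a
  have h := restr_restr_skip n i j 1 hij (by omega) a
  have h' := congrFun (congrArg GammaOp.Hom.toFun (fold_unfold_comp hij f hf)) a
  simp only [comp_toFun, Function.comp_apply] at h h' ⊢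
  rw [h]
  simp only [kill]
  split_ifs
  · exact (unfold n i j hij ≫ f).map_zero
  · exact h'

/-- Two indices with the same image, one in `A₊` and the other in `A₋`, may be sent to the base
point. -/
theorem IsFormalDifferenceLaw.act_kill {A : DiscreteGammaRing.{u}} {r : A.El 2}
    (hr : IsFormalDifferenceLaw A r) {k p i j : ℕ} (hij : 1 ≤ i ∧ i < j ∧ j ≤ 2 ^ k)
    (hA : (InAplus i ∧ ¬ InAplus j) ∨ (InAplus j ∧ ¬ InAplus i))
    (f : (⟨2 ^ k⟩ : GammaOp) ⟶ ⟨p⟩)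
    (hf : f.toFun (⟨i, by omega⟩ : Fin (2 ^ k + 1)) =
      f.toFun (⟨j, by omega⟩ : Fin (2 ^ k + 1))) :
    A.act (kill f i j) (A.pow r k) = A.act f (A.pow r k) := by
  have h := hr.cancel k i j 1 hij (by omega) hA
  rw [← restr_restr_skip_unfold hij f hf, A.act_comp, A.act_comp, A.act_comp, ← h, ← A.act_comp,
    fold_unfold_comp hij f hf]

/-! ### The formal difference law `(1, -1)` in `Hℤ` -/

/-- Adding `2 ^ k` puts one more digit `1` in front. The induction strips the lowest digit. -/
theorem count_one_digits_add_two_pow (k i : ℕ) (hi : i < 2 ^ k) :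
    (Nat.digits 2 (i + 2 ^ k)).count 1 = (Nat.digits 2 i).count 1 + 1 := by
  induction k generalizing i with
  | zero =>
    obtain rfl : i = 0 := by simpa using hi
    simp
  | succ k ih =>
    have h1 : (i + 2 ^ (k + 1)) % 2 = i % 2 := by omega
    have h2 : (i + 2 ^ (k + 1)) / 2 = i / 2 + 2 ^ k := by omega
    rw [Nat.digits_def' one_lt_two (by positivity), h1, h2, List.count_cons, ih _ (by omega)]
    -- Zero has an empty digit list, so no lowest digit can be split off.
    rcases Nat.eq_zero_or_pos i with rfl | hpos
    · simp
    · rw [Nat.digits_def' one_lt_two hpos, List.count_cons]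
      ring

open Classical in
/-- The vector which is `1` on `A₊` and `-1` on `A₋`. -/
noncomputable def sgn (k : ℕ) (z : Fin (2 ^ k)) : ℤ := if InAplus (z + 1) then 1 else -1

/-- The pair `(i, j)` has index `i + 2 ^ k * j`, so `j = 1` adds a binary digit `1` and flips the
parity. -/
theorem sgn_colex (k : ℕ) (i : Fin (2 ^ k)) (j : Fin 2) :
    sgn (k + 1) (colex (2 ^ k) 2 (i, j)) = sgn k i * ![1, -1] j := by
  classical
  simp only [sgn, InAplus, colex_val, Nat.add_sub_cancel]
  fin_cases j
  · simp
  · have h := count_one_digits_add_two_pow k i i.2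
    simp only [Fin.mk_one, mul_one, h, Nat.even_add_one, Matrix.cons_val_one,
      Matrix.cons_val_fin_one]
    split_ifs <;> simp_all

theorem pow_plusMinusOne (k : ℕ) : HZ.pow plusMinusOne k = sgn k := by
  induction k with
  | zero =>
    funext z
    obtain rfl : z = (0 : Fin 1) := Subsingleton.elim (α := Fin 1) _ _
    simp [sgn, InAplus]
    rfl
  | succ k ih =>
    funext z
    obtain ⟨⟨i, j⟩, rfl⟩ := (colex (2 ^ k) 2).surjective z
    rw [sgn_colex, ← ih]
    exact HZmul_colex _ _ _ _

/-- The entries at `i` and `j` land in the same place under `s` and sum to zero there; under `t`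
they are dropped. -/
theorem HZmap_eq_of_cancel {n : ℕ} {p : GammaOp} (s t : (⟨n⟩ : GammaOp) ⟶ p) (a : Fin n → ℤ)
    {i j : Fin n} (hij : i ≠ j) (hs : s.toFun i.succ = s.toFun j.succ)
    (hti : t.toFun i.succ = 0) (htj : t.toFun j.succ = 0) (ha : a i + a j = 0)
    (hst : ∀ x, x ≠ i → x ≠ j → s.toFun x.succ = t.toFun x.succ) : HZmap s a = HZmap t a := by
  funext y
  rw [← sub_eq_zero]
  simp only [HZmap]
  rw [← Finset.sum_sub_distrib, Fintype.sum_eq_add i j hij]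
  · rw [hs, hti, htj]
    have h0 : (0 : Fin (p.card + 1)) ≠ y.succ := (Fin.succ_ne_zero y).symm
    simp only [if_neg h0]
    split_ifs
    · linarith
    · rfl
  · rintro x ⟨h1, h2⟩
    rw [hst x h1 h2, sub_self]

theorem isFormalDifferenceLaw_plusMinusOne : IsFormalDifferenceLaw HZ plusMinusOne where
  restr_two := by
    change HZmap _ (![1, -1] : Fin 2 → ℤ) = HZunit 1 1
    decide
  fold_one_two := by
    change HZmap _ (![1, -1] : Fin 2 → ℤ) = 0
    decide
  neg_mul := by
    change HZmul (HZmap _ (![1, -1] : Fin 2 → ℤ)) (![1, -1] : Fin 2 → ℤ) =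
      HZmap _ (![1, -1] : Fin 2 → ℤ)
    decide
  mul_neg := by
    change HZmul (![1, -1] : Fin 2 → ℤ) (HZmap _ (![1, -1] : Fin 2 → ℤ)) =
      HZmap _ (![1, -1] : Fin 2 → ℤ)
    decide
  symm k π hπ hA := by
    rw [pow_plusMinusOne]
    change HZmap _ _ = _
    funext y
    -- The fibre of `π` over `y` is one point `x`, so the coordinate sum has a single term, whose
    -- sign is that of `y`.
    obtain ⟨x, hx⟩ := Fin.exists_succ_eq.2
      (show π.symm y.succ ≠ 0 from fun h => Fin.succ_ne_zero y (by
        rw [← hπ, ← h, Equiv.apply_symm_apply]))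
    have hx' : π x.succ = y.succ := by rw [hx, Equiv.apply_symm_apply]
    have h1 : ∀ z : Fin (2 ^ k), (π z.succ = y.succ) = (z = x) := fun z => by
      rw [← hx', π.injective.eq_iff, Fin.succ_inj]
    change (∑ z : Fin (2 ^ k), if π z.succ = y.succ then sgn k z else 0) = _
    simp only [h1, Finset.sum_ite_eq', Finset.mem_univ, if_true]
    have h2 := hA x.succ (Fin.succ_ne_zero x)
    rw [hx'] at h2
    simp only [Fin.val_succ] at h2
    classical exact if_congr h2.symm rfl rfl
  cancel k i j l hij hl hA := by
    rw [← HZ.act_comp, ← HZ.act_comp, pow_plusMinusOne]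
    have hi : ((⟨i - 1, by omega⟩ : Fin (2 ^ k)).succ : ℕ) = i := by
      simp only [Fin.succ_mk]; omega
    have hj : ((⟨j - 1, by omega⟩ : Fin (2 ^ k)).succ : ℕ) = j := by
      simp only [Fin.succ_mk]; omega
    refine HZmap_eq_of_cancel _ _ _ (i := ⟨i - 1, by omega⟩) (j := ⟨j - 1, by omega⟩) ?_ ?_ ?_ ?_
      ?_ ?_
    · simp only [ne_eq, Fin.mk.injEq]
      omega
    · apply Fin.ext
      simp only [fold, hi, hj, true_or, or_true, dif_pos]
    · rw [restr_restr_skip _ _ _ _ hij, hi, if_pos (Or.inl rfl)]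
    · rw [restr_restr_skip _ _ _ _ hij, hj, if_pos (Or.inr rfl)]
    · rw [show i = i - 1 + 1 by omega, show j = j - 1 + 1 by omega] at hA
      simp only [sgn]
      rcases hA with ⟨h1, h2⟩ | ⟨h1, h2⟩
      · rw [if_pos h1, if_neg h2, add_neg_cancel]
      · rw [if_neg h2, if_pos h1, neg_add_cancel]
    · intro x hxi hxj
      rw [restr_restr_skip _ _ _ _ hij, if_neg]
      rw [Fin.val_succ]
      rw [ne_eq, Fin.ext_iff] at hxi hxj
      dsimp only at hxi hxj
      omega

/-- Every element of `Hℤ[n]` is the image of a power of `(1, -1)`. -/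
theorem exists_act_pow_plusMinusOne {n : ℕ} (a : HZ.El n) :
    ∃ (k : ℕ) (f : (⟨2 ^ k⟩ : GammaOp) ⟶ ⟨n⟩), HZ.act f (HZ.pow plusMinusOne k) = a := by
  -- The representable vectors form a subgroup. Closure under differences is the natural criterion,
  -- because the last factor `(1, -1)` of a power produces a difference.
  let S : AddSubgroup (Fin n → ℤ) := AddSubgroup.ofSub
    {a : Fin n → ℤ | ∃ (k : ℕ) (f : (⟨2 ^ k⟩ : GammaOp) ⟶ ⟨n⟩), HZmap f (sgn k) = a}
    ⟨0, 0, homOf fun _ => 0, by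
      funext y
      simp [HZmap, (Fin.succ_ne_zero _).symm]⟩ (by
    intro a ha b hb
    obtain ⟨k, f, g, rfl, rfl⟩ : ∃ (k : ℕ) (f g : (⟨2 ^ k⟩ : GammaOp) ⟶ ⟨n⟩),
        HZmap f (sgn k) = a ∧ HZmap g (sgn k) = b := by
      -- Exponents can be raised, so both vectors may be represented with the same `k`.
      have key : ∀ (k m : ℕ) (f : (⟨2 ^ k⟩ : GammaOp) ⟶ ⟨n⟩),
          ∃ f' : (⟨2 ^ (k + m)⟩ : GammaOp) ⟶ ⟨n⟩,
            HZmap f' (sgn (k + m)) = HZmap f (sgn k) := by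
        intro k m f
        refine ⟨DiscreteGammaRing.halves k m ≫ f, ?_⟩
        rw [← pow_plusMinusOne, ← pow_plusMinusOne]
        exact (HZ.act_comp _ _ _).trans (congrArg (HZ.act f)
          (HZ.act_halves isFormalDifferenceLaw_plusMinusOne.restr_two k m))
      obtain ⟨k, f, rfl⟩ := ha
      obtain ⟨l, g, rfl⟩ := hb
      rcases le_total k l with h | h <;> obtain ⟨m, rfl⟩ := Nat.exists_eq_add_of_le h
      · obtain ⟨f', hf'⟩ := key k m f
        exact ⟨_, f', g, hf', rfl⟩
      · obtain ⟨g', hg'⟩ := key l m g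
        exact ⟨_, f, g', rfl, hg'⟩
    -- `F` is `f` on the first half and `g` on the second, where all signs are reversed; its image
    -- is the difference.
    let F : (⟨2 ^ k * 2⟩ : GammaOp) ⟶ ⟨n⟩ :=
      homOf fun z => ![f.toFun ((colex (2 ^ k) 2).symm z).1.succ,
        g.toFun ((colex (2 ^ k) 2).symm z).1.succ] ((colex (2 ^ k) 2).symm z).2
    have hF : ∀ i j, F.toFun (colex (2 ^ k) 2 (i, j)).succ =
        ![f.toFun i.succ, g.toFun i.succ] j := fun i j => by
      simp only [F, homOf_succ, Equiv.symm_apply_apply]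
    refine ⟨k + 1, F, ?_⟩
    funext y
    change (∑ z : Fin (2 ^ k * 2), if F.toFun z.succ = y.succ then sgn (k + 1) z else 0) = _
    rw [← (colex (2 ^ k) 2).sum_comp, Fintype.sum_prod_type, Finset.sum_comm]
    simp only [hF, sgn_colex, Fin.sum_univ_two]
    simp only [HZmap, Pi.add_apply, Pi.neg_apply, ← Finset.sum_neg_distrib]
    congr 1
    · simp
    · refine Finset.sum_congr rfl fun i _ => ?_
      simp only [Matrix.cons_val_one, Matrix.cons_val_fin_one]
      split_ifs <;> simp)
  have hS : ∀ a : Fin n → ℤ, a ∈ S := by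
    intro a
    have h1 : a = ∑ i, a i • (Pi.single i 1 : Fin n → ℤ) := by
      funext y
      simp [Finset.sum_apply, Pi.single_apply]
    rw [h1]
    refine sum_mem fun i _ => zsmul_mem ?_ _
    -- A basis vector is an image of the zeroth power, the unit.
    refine ⟨0, homOf fun _ => i.succ, ?_⟩
    funext y
    change (∑ z : Fin 1, _) = _
    simp [Pi.single_apply, sgn, InAplus, eq_comm, homOf, Fin.succ_inj]
  obtain ⟨k, f, hf⟩ := hS a
  exact ⟨k, f, by rw [pow_plusMinusOne]; exact hf⟩

/-! ### Maps with the same signed fibre counts -/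

/-- A pointed map `f : [n] → [p]` is pure with respect to `P` if no fibre over an element different
from the base point meets both `P` and its complement. -/
def IsPure {n p : ℕ} (P : Fin n → Prop) (f : (⟨n⟩ : GammaOp) ⟶ ⟨p⟩) : Prop :=
  ∀ i j : Fin n, f.toFun i.succ = f.toFun j.succ → f.toFun i.succ ≠ 0 → P i → P j

open Classical in
/-- The number of elements of the fibre of `f` over `y` on which `P` has the truth value `b`. -/
noncomputable def fibreCard {n p : ℕ} (P : Fin n → Prop) (f : (⟨n⟩ : GammaOp) ⟶ ⟨p⟩)
    (b : Bool) (y : Fin (p + 1)) : ℕ :=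
  (Finset.univ.filter fun i : Fin n => decide (P i) = b ∧ f.toFun i.succ = y).card

/-- The total does not depend on `f`. This controls the fibre over the base point, which `HZmap`
does not see. -/
theorem sum_fibreCard {n p : ℕ} (P : Fin n → Prop) (f : (⟨n⟩ : GammaOp) ⟶ ⟨p⟩) (b : Bool)
    [DecidablePred P] :
    ∑ y, fibreCard P f b y = (Finset.univ.filter fun i : Fin n => decide (P i) = b).card := by
  classical
  rw [Finset.card_eq_sum_card_fiberwise (f := fun i : Fin n => f.toFun i.succ)
    (t := Finset.univ) (fun _ _ => Finset.mem_coe.2 (Finset.mem_univ _))]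
  refine Finset.sum_congr rfl fun y _ => ?_
  rw [fibreCard, Finset.filter_filter]
  congr!

theorem HZmap_sign {n p : ℕ} (P : Fin n → Prop) [DecidablePred P]
    (f : (⟨n⟩ : GammaOp) ⟶ ⟨p⟩) (y : Fin p) :
    HZmap f (fun i => if P i then 1 else -1) y =
      fibreCard P f true y.succ - fibreCard P f false y.succ := by
  simp only [HZmap, fibreCard, Finset.card_filter, Nat.cast_sum, ← Finset.sum_sub_distrib]
  refine Finset.sum_congr rfl fun i _ => ?_
  by_cases h1 : P i <;> by_cases h2 : f.toFun i.succ = y.succ <;> simp [h1, h2]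

theorem IsPure.fibreCard_eq_zero {n p : ℕ} {P : Fin n → Prop} {f : (⟨n⟩ : GammaOp) ⟶ ⟨p⟩}
    (hf : IsPure P f) (y : Fin p) :
    fibreCard P f true y.succ = 0 ∨ fibreCard P f false y.succ = 0 := by
  by_contra! h
  simp only [fibreCard, ne_eq, Finset.card_eq_zero, ← Finset.nonempty_iff_ne_empty] at h
  obtain ⟨⟨i, hi⟩, j, hj⟩ := h
  simp only [Finset.mem_filter, Finset.mem_univ, true_and, decide_eq_true_eq,
    decide_eq_false_iff_not] at hi hj
  exact hj.1 (hf i j (hi.2.trans hj.2.symm) (by rw [hi.2]; exact Fin.succ_ne_zero y) hi.1)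

/-- Off the base point one of the two counts vanishes, so their difference, a coordinate of the
image, determines both. The counts over the base point follow from the totals. -/
theorem IsPure.fibreCard_eq {n p : ℕ} {P : Fin n → Prop} [DecidablePred P]
    {f g : (⟨n⟩ : GammaOp) ⟶ ⟨p⟩} (hf : IsPure P f) (hg : IsPure P g)
    (h : HZmap f (fun i => if P i then 1 else -1) = HZmap g fun i => if P i then 1 else -1)
    (b : Bool) (y : Fin (p + 1)) : fibreCard P f b y = fibreCard P g b y := by
  have hsucc : ∀ (b : Bool) (y : Fin p), fibreCard P f b y.succ = fibreCard P g b y.succ := by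
    intro b y
    have h1 := congrFun h y
    rw [HZmap_sign, HZmap_sign] at h1
    have h2 := hf.fibreCard_eq_zero y
    have h3 := hg.fibreCard_eq_zero y
    cases b <;> omega
  cases y using Fin.cases with
  | succ y => exact hsucc b y
  | zero =>
    have h1 := (sum_fibreCard P f b).trans (sum_fibreCard P g b).symm
    rw [Fin.sum_univ_succ, Fin.sum_univ_succ, Finset.sum_congr rfl fun y _ => hsucc b y] at h1
    exact Nat.add_right_cancel h1

/-- Label each element by its truth value under `P` and its image. Classes with the same label are
equinumerous for `f` and `g`, and bijections between them glue to `π`. -/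
theorem exists_perm_of_fibreCard_eq {n p : ℕ} {P : Fin n → Prop}
    {f g : (⟨n⟩ : GammaOp) ⟶ ⟨p⟩} (h : ∀ b y, fibreCard P f b y = fibreCard P g b y) :
    ∃ π : Equiv.Perm (Fin n), (∀ i, P (π i) ↔ P i) ∧ ∀ i, g.toFun (π i).succ = f.toFun i.succ := by
  classical
  let F (f : (⟨n⟩ : GammaOp) ⟶ ⟨p⟩) (i : Fin n) : Bool × Fin (p + 1) :=
    (decide (P i), f.toFun i.succ)
  have e : ∀ c, Nonempty ({i // F f i = c} ≃ {i // F g i = c}) := by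
    rintro ⟨b, y⟩
    rw [← Fintype.card_eq, Fintype.card_subtype, Fintype.card_subtype]
    have := h b y
    simp only [fibreCard] at this
    simp only [F, Prod.mk.injEq]
    convert this
  have hF := Equiv.ofFiberEquiv_map fun c => (e c).some
  refine ⟨Equiv.ofFiberEquiv fun c => (e c).some, fun i => ?_, fun i => ?_⟩
  · simpa [F] using congrArg Prod.fst (hF i)
  · exact congrArg Prod.snd (hF i)

/-! ### The multiplicative map of a formal difference law -/

/-- The termination measure for `exists_isPure`. -/
theorem card_kill_lt {n p : ℕ} (f : (⟨n⟩ : GammaOp) ⟶ ⟨p⟩) (i : Fin n) (j : ℕ)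
    (hi : f.toFun i.succ ≠ 0) :
    (Finset.univ.filter fun x : Fin n => (kill f (i + 1) j).toFun x.succ ≠ 0).card <
      (Finset.univ.filter fun x : Fin n => f.toFun x.succ ≠ 0).card := by
  apply Finset.card_lt_card
  rw [Finset.ssubset_iff_of_subset]
  · refine ⟨i, by simpa using hi, ?_⟩
    simp [kill]
  · intro x hx
    rw [Finset.mem_filter] at hx ⊢
    exact ⟨Finset.mem_univ x, fun h => hx.2 (by simp only [kill, h, ite_self])⟩

theorem kill_comm {n p : ℕ} (f : (⟨n⟩ : GammaOp) ⟶ ⟨p⟩) (i j : ℕ) : kill f i j = kill f j i := by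
  apply GammaOp.Hom.ext
  funext x
  simp only [kill, or_comm]

theorem IsFormalDifferenceLaw.act_kill_succ {A : DiscreteGammaRing.{u}} {r : A.El 2}
    (hr : IsFormalDifferenceLaw A r) {k p : ℕ} (f : (⟨2 ^ k⟩ : GammaOp) ⟶ ⟨p⟩)
    {i j : Fin (2 ^ k)} (hi : InAplus (i + 1)) (hj : ¬ InAplus (j + 1))
    (hf : f.toFun i.succ = f.toFun j.succ) :
    A.act (kill f (i + 1) (j + 1)) (A.pow r k) = A.act f (A.pow r k) := by
  rcases lt_trichotomy i j with h | rfl | h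
  · exact hr.act_kill (i := i + 1) (j := j + 1) (by omega) (Or.inl ⟨hi, hj⟩) f hf
  · exact absurd hi hj
  · rw [kill_comm]
    exact hr.act_kill (i := j + 1) (j := i + 1) (by omega) (Or.inr ⟨hi, hj⟩) f hf.symm

/-- A map that is not pure has two elements of opposite sign in a fibre off the base point; `kill`
removes them. The image in `HZ` is unchanged as well, since `(1, -1)` is itself a formal difference
law. -/
theorem IsFormalDifferenceLaw.exists_isPure {A : DiscreteGammaRing.{u}} {r : A.El 2}
    (hr : IsFormalDifferenceLaw A r) {k p : ℕ} (f : (⟨2 ^ k⟩ : GammaOp) ⟶ ⟨p⟩) :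
    ∃ g : (⟨2 ^ k⟩ : GammaOp) ⟶ ⟨p⟩, IsPure (fun i : Fin (2 ^ k) => InAplus (i + 1)) g ∧
      A.act g (A.pow r k) = A.act f (A.pow r k) ∧
      HZ.act g (HZ.pow plusMinusOne k) = HZ.act f (HZ.pow plusMinusOne k) := by
  induction hc : (Finset.univ.filter fun x : Fin (2 ^ k) => f.toFun x.succ ≠ 0).card
    using Nat.strong_induction_on generalizing f with
  | _ c ih =>
    by_cases hp : IsPure (fun i : Fin (2 ^ k) => InAplus (i + 1)) f
    · exact ⟨f, hp, rfl, rfl⟩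
    · simp only [IsPure] at hp
      push Not at hp
      obtain ⟨i, j, hij, h0, hi, hj⟩ := hp
      obtain ⟨g, hg, h1, h2⟩ := ih _ (hc ▸ card_kill_lt f i (j + 1) h0) _ rfl
      exact ⟨g, hg, h1.trans (hr.act_kill_succ f hi hj hij),
        h2.trans (isFormalDifferenceLaw_plusMinusOne.act_kill_succ f hi hj hij)⟩

theorem IsFormalDifferenceLaw.act_pow_eq_of_isPure {A : DiscreteGammaRing.{u}} {r : A.El 2}
    (hr : IsFormalDifferenceLaw A r) {k p : ℕ} {f g : (⟨2 ^ k⟩ : GammaOp) ⟶ ⟨p⟩}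
    (hf : IsPure (fun i : Fin (2 ^ k) => InAplus (i + 1)) f)
    (hg : IsPure (fun i : Fin (2 ^ k) => InAplus (i + 1)) g)
    (h : HZ.act f (HZ.pow plusMinusOne k) = HZ.act g (HZ.pow plusMinusOne k)) :
    A.act f (A.pow r k) = A.act g (A.pow r k) := by
  classical
  rw [pow_plusMinusOne] at h
  obtain ⟨π, hπ, hπg⟩ := exists_perm_of_fibreCard_eq (hf.fibreCard_eq hg (by
    refine Eq.trans ?_ (h.trans ?_)
    · change _ = HZmap f (sgn k)
      congr 1
    · change HZmap g (sgn k) = _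
      congr 1))
  -- `decomposeFin.symm (0, π)` extends `π` to the pointed set by fixing the base point.
  have h0 : Equiv.Perm.decomposeFin.symm (0, π) 0 = 0 :=
    Equiv.Perm.decomposeFin_symm_apply_zero 0 π
  have hs : ∀ i : Fin (2 ^ k), Equiv.Perm.decomposeFin.symm (0, π) i.succ = (π i).succ :=
    fun i => by simp [Equiv.Perm.decomposeFin_symm_apply_succ]
  have h1 := hr.symm k (Equiv.Perm.decomposeFin.symm (0, π)) h0 (by
    intro i hi
    obtain ⟨i, rfl⟩ := Fin.exists_succ_eq.2 hi
    rw [hs]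
    exact hπ i)
  have h2 : permMap _ h0 ≫ g = f := by
    apply hom_ext
    intro i
    refine Eq.trans ?_ (hπg i)
    exact congrArg g.toFun (hs i)
  rw [← h2, A.act_comp, h1]

theorem IsFormalDifferenceLaw.act_pow_eq_of_same_exponent {A : DiscreteGammaRing.{u}} {r : A.El 2}
    (hr : IsFormalDifferenceLaw A r) {k p : ℕ} {f g : (⟨2 ^ k⟩ : GammaOp) ⟶ ⟨p⟩}
    (h : HZ.act f (HZ.pow plusMinusOne k) = HZ.act g (HZ.pow plusMinusOne k)) :
    A.act f (A.pow r k) = A.act g (A.pow r k) := by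
  obtain ⟨f', hf, hf1, hf2⟩ := hr.exists_isPure f
  obtain ⟨g', hg, hg1, hg2⟩ := hr.exists_isPure g
  rw [← hf1, ← hg1]
  exact hr.act_pow_eq_of_isPure hf hg (hf2.trans (h.trans hg2.symm))

theorem IsFormalDifferenceLaw.act_halves_comp {A : DiscreteGammaRing.{u}} {r : A.El 2}
    (hr : IsFormalDifferenceLaw A r) {k p : ℕ} (m : ℕ) (f : (⟨2 ^ k⟩ : GammaOp) ⟶ ⟨p⟩) :
    A.act (DiscreteGammaRing.halves k m ≫ f) (A.pow r (k + m)) = A.act f (A.pow r k) := by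
  rw [A.act_comp, A.act_halves hr.restr_two]

/-- The image of `r ^ k` under `f` depends only on the image of `(1, -1) ^ k` under `f`. -/
theorem IsFormalDifferenceLaw.act_pow_eq {A : DiscreteGammaRing.{u}} {r : A.El 2}
    (hr : IsFormalDifferenceLaw A r) {k l p : ℕ} {f : (⟨2 ^ k⟩ : GammaOp) ⟶ ⟨p⟩}
    {g : (⟨2 ^ l⟩ : GammaOp) ⟶ ⟨p⟩}
    (h : HZ.act f (HZ.pow plusMinusOne k) = HZ.act g (HZ.pow plusMinusOne l)) :
    A.act f (A.pow r k) = A.act g (A.pow r l) := by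
  wlog hkl : k ≤ l generalizing k l
  · exact (this h.symm (le_of_not_ge hkl)).symm
  obtain ⟨m, rfl⟩ := Nat.exists_eq_add_of_le hkl
  rw [← hr.act_halves_comp m f]
  apply hr.act_pow_eq_of_same_exponent
  rw [isFormalDifferenceLaw_plusMinusOne.act_halves_comp, h]

/-- The value at `a ∈ ℤⁿ` of the multiplicative map defined by `r`. -/
noncomputable def extend (A : DiscreteGammaRing.{u}) (r : A.El 2) (n : ℕ) (a : HZ.El n) : A.El n :=
  A.act (exists_act_pow_plusMinusOne a).choose_spec.choose
    (A.pow r (exists_act_pow_plusMinusOne a).choose)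

/-- The choices in `extend` do not matter, so its properties can be checked on any presentation. -/
theorem IsFormalDifferenceLaw.extend_act {A : DiscreteGammaRing.{u}} {r : A.El 2}
    (hr : IsFormalDifferenceLaw A r) {k n : ℕ} (f : (⟨2 ^ k⟩ : GammaOp) ⟶ ⟨n⟩) :
    extend A r n (HZ.act f (HZ.pow plusMinusOne k)) = A.act f (A.pow r k) :=
  hr.act_pow_eq (exists_act_pow_plusMinusOne _).choose_spec.choose_spec

theorem DiscreteGammaRing.unit_eq_act (A : DiscreteGammaRing.{u}) (r : A.El 2) {n : ℕ}
    (x : Fin (n + 1)) : A.ring.unit n x =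
      A.act (homOf fun _ => x : (⟨2 ^ 0⟩ : GammaOp) ⟶ ⟨n⟩) (A.pow r 0) :=
  (A.ring.unit_natural (homOf fun _ => x : (⟨1⟩ : GammaOp) ⟶ ⟨n⟩) 1).symm

/-- The pointed map on the right depends on neither `A` nor `r`, so the formula in `HZ` and the
formula in `A` match under `extend`. -/
theorem DiscreteGammaRing.mul_act_pow (A : DiscreteGammaRing.{u}) (r : A.El 2) {k l m n : ℕ}
    (f : (⟨2 ^ k⟩ : GammaOp) ⟶ ⟨m⟩) (g : (⟨2 ^ l⟩ : GammaOp) ⟶ ⟨n⟩) :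
    A.mul (A.act f (A.pow r k)) (A.act g (A.pow r l)) =
      A.act (castMap (pow_add 2 k l) ≫ smash f g) (A.pow r (k + l)) := by
  have h : castMap (pow_add 2 k l).symm ≫ castMap (pow_add 2 k l) ≫ smash f g = smash f g := rfl
  rw [← A.act_smash, ← A.act_castMap_pow_mul r k l (pow_add 2 k l).symm, ← A.act_comp, h]

/-- The multiplicative map `Hℤ → A` which sends `(1, -1)` to the formal difference law `r`. -/
noncomputable def IsFormalDifferenceLaw.multMap {A : DiscreteGammaRing.{u}} {r : A.El 2}
    (hr : IsFormalDifferenceLaw A r) : MultMap HZ A where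
  toFun := extend A r
  map_point n := by
    -- Zero is presented as the unit at the base point.
    have h1 : HZ.act (homOf fun _ => 0 : (⟨2 ^ 0⟩ : GammaOp) ⟶ ⟨n⟩) (HZ.pow plusMinusOne 0) =
        HZ.zero n := by
      rw [← HZ.unit_eq_act]
      exact HZ.ring.unit_zero n
    rw [← h1, hr.extend_act, ← A.unit_eq_act]
    exact A.ring.unit_zero n
  natural f a := by
    obtain ⟨k, g, rfl⟩ := exists_act_pow_plusMinusOne a
    rw [← HZ.act_comp, hr.extend_act, hr.extend_act, A.act_comp]
  map_unit n x := by
    rw [HZ.unit_eq_act plusMinusOne, hr.extend_act, ← A.unit_eq_act]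
  map_mul a b := by
    obtain ⟨k, f, rfl⟩ := exists_act_pow_plusMinusOne a
    obtain ⟨l, g, rfl⟩ := exists_act_pow_plusMinusOne b
    rw [HZ.mul_act_pow, hr.extend_act, hr.extend_act, hr.extend_act, A.mul_act_pow]

theorem IsFormalDifferenceLaw.multMap_plusMinusOne {A : DiscreteGammaRing.{u}} {r : A.El 2}
    (hr : IsFormalDifferenceLaw A r) : hr.multMap.toFun 2 plusMinusOne = r := by
  have h := hr.extend_act (k := 1) (castMap (by norm_num) : (⟨2 ^ 1⟩ : GammaOp) ⟶ ⟨2⟩)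
  rwa [HZ.act_castMap_pow_one, A.act_castMap_pow_one] at h

theorem MultMap.ext_plusMinusOne {A : DiscreteGammaRing.{u}} {φ ψ : MultMap HZ A}
    (h : φ.toFun 2 plusMinusOne = ψ.toFun 2 plusMinusOne) : φ = ψ := by
  apply MultMap.ext
  funext n a
  obtain ⟨k, f, rfl⟩ := exists_act_pow_plusMinusOne a
  rw [φ.natural, ψ.natural, φ.map_pow, ψ.map_pow, h]

/-- Multiplicative maps `Hℤ → A` are the same as formal difference laws in `A`. -/
noncomputable def multMapEquiv (A : DiscreteGammaRing.{u}) :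
    MultMap HZ A ≃ {r : A.El 2 // IsFormalDifferenceLaw A r} where
  toFun φ := ⟨φ.toFun 2 plusMinusOne, isFormalDifferenceLaw_plusMinusOne.map φ⟩
  invFun r := r.2.multMap
  left_inv _ := MultMap.ext_plusMinusOne (IsFormalDifferenceLaw.multMap_plusMinusOne _)
  right_inv r := Subtype.ext r.2.multMap_plusMinusOne

/-- `multMapEquiv` as a natural isomorphism of functors on discrete Γ-rings. -/
noncomputable def hzMapSetIso : HZMapSet.{u} ≅ FDLSet.{u} :=
  NatIso.ofComponents (fun A => (multMapEquiv A).toIso) fun _ => rfl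

end GammaSp

open GammaSp in
theorem theorem3p8 :
    ∃ e : HZMaps.{u} ≅ FDL.{u},
      ∀ (R : GammaRing.{u}) (d : SimplexCategoryᵒᵖ) (φ : (HZMaps.obj R).obj d),
        FDL.elt ((e.hom.app R).app d φ) = (HZMaps.toMultMap φ).toFun 2 plusMinusOne :=
  -- Both functors pass to the simplicial discrete Γ-ring of levels and then work degreewise, so
  -- whiskering the discrete isomorphism suffices.
  ⟨Functor.isoWhiskerLeft GammaRing.levelsFunctor
    ((SimplicialObject.whiskering _ _).mapIso hzMapSetIso), fun _ _ _ => rfl⟩
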